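/- An ordered graph is a finite simple graph equipped with a linear ordering of its vertex set, and its subgraphs inherit the ordering; vertices are laid out from left to right in increasing order. For ordered graphs $H,H'$ let $R_<(H,H')$ be the set of ordered Ramsey graphs of $(H,H')$, that is, of all ordered graphs $F$ such that each coloring of the edges of $F$ in red and blue has a copy of $H$ (a not necessarily induced ordered subgraph, with an order-preserving isomorphism) with all edges red or a copy of $H'$ with all edges blue. For a graph $G$ let $m(G)=\max\{|E(G')|/|V(G')| : G'\subseteq G,\ V(G')\neq\emptyset\}$, and let $r^m_<(H,H')=\inf\{m(F) : F\in R_<(H,H')\}$. A partial matching is a graph without a copy of the path $P_3$ on three vertices. A right (left) star is an ordered star with all its leaves to the right (left) of its center, and a monotone path is an ordered path $u_1\cdots u_n$ with $u_1<\cdots<u_n$; a single vertex counts as a right star, a left star and a monotone path. **Theorem.** Let $H$ and $H'$ be ordered graphs with at least one edge each. Then the following three statements are equivalent: (a) $r^m_<(H,H')<1$; (b) $R_<(H,H')$ contains a forest; (c) $H$ and $H'$ are forests and at least one of the following holds: 1. $H$ or $H'$ is a partial matching; 2. each component of one of $H,H'$ is a right star, and in the other each vertex has at most one neighbor to the left;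 3. each component of one of $H,H'$ is a left star, and in the other each vertex has at most one neighbor to the right; 4. each component of one of $H,H'$ is a left star or a right star, and each component of the other is a monotone path. Moreover, $R_<(H,H')$ contains a partial matching if and only if both $H$ and $H'$ are partial matchings. -/

import Mathlib

open scoped ENNReal

universe u v w

/-- An ordered graph: a finite simple graph together with a linear order of its vertex set. -/
structure OrderedGraph : Type (u + 1) where
  V : Type u
  [finite : Finite V]
  [order : LinearOrder V]
  graph : SimpleGraph V

namespace OrderedGraph

attribute [instance] OrderedGraph.finite OrderedGraph.order

/-- The colors of the edges. -/
inductive Color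
  | red
  | blue

/-- The spanning ordered subgraph of `F` formed by the edges that have color `k` under the
edge-coloring `c`. -/
abbrev colorClass (F : OrderedGraph.{u}) (c : F.graph.edgeSet → Color) (k : Color) :
    OrderedGraph.{u} where
  V := F.V
  graph := SimpleGraph.fromEdgeSet {e | ∃ h : e ∈ F.graph.edgeSet, c ⟨e, h⟩ = k}

/-- `G` contains a copy of `H`: an order-isomorphic copy of `H` is a (not necessarily induced)
ordered subgraph of `G`. -/
def ContainsCopy (G : OrderedGraph.{u}) (H : OrderedGraph.{v}) : Prop :=
  ∃ f : H.V → G.V, StrictMono f ∧ ∀ a b, H.graph.Adj a b → G.graph.Adj (f a) (f b)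

/-- `F → (H, H')`: each coloring of the edges of `F` in red and blue has a copy of `H` with all
edges red or a copy of `H'` with all edges blue. -/
def IsRamsey (F : OrderedGraph.{u}) (H : OrderedGraph.{v}) (H' : OrderedGraph.{w}) : Prop :=
  ∀ c : F.graph.edgeSet → Color,
    (F.colorClass c Color.red).ContainsCopy H ∨ (F.colorClass c Color.blue).ContainsCopy H'

/-- The set `R_<(H, H')` of ordered Ramsey graphs of `(H, H')`. As ordered graphs are finite,
each of them is isomorphic to one whose vertices form a type in `Type`. -/
def ramseyGraphs (H : OrderedGraph.{v}) (H' : OrderedGraph.{w}) : Set OrderedGraph.{0} :=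
  {F | F.IsRamsey H H'}

/-- The density `m(G)`: the maximum of `|E(G')| / |V(G')|` over all (non-null) subgraphs `G'`
of `G`. -/
noncomputable def density (G : OrderedGraph.{u}) : ℝ≥0∞ :=
  ⨆ (G' : G.graph.Subgraph) (_ : G'.verts.Nonempty),
    (G'.edgeSet.ncard : ℝ≥0∞) / (G'.verts.ncard : ℝ≥0∞)

/-- The ordered Ramsey density `r_<^m(H, H')`: the infimum of the densities of the ordered Ramsey
graphs of `(H, H')`. -/
noncomputable def ramseyDensity (H : OrderedGraph.{v}) (H' : OrderedGraph.{w}) : ℝ≥0∞ :=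
  ⨅ F ∈ ramseyGraphs H H', F.density

/-- A forest is a graph without cycles. -/
def IsForest (G : OrderedGraph.{u}) : Prop := G.graph.IsAcyclic

/-- A partial matching is a graph without any copy of the path `P_3` on three vertices. -/
def IsPartialMatching (G : OrderedGraph.{u}) : Prop :=
  (SimpleGraph.pathGraph 3).Free G.graph

/-- A right star: a star with all its leaves to the right of its center. A single vertex is the
right star without leaves. -/
def IsRightStar (G : OrderedGraph.{u}) : Prop :=
  ∃ z : G.V, (∀ x, x ≠ z → z < x) ∧ G.graph = SimpleGraph.starGraph z

/-- A left star: a star with all its leaves to the left of its center. A single vertex is the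
left star without leaves. -/
def IsLeftStar (G : OrderedGraph.{u}) : Prop :=
  ∃ z : G.V, (∀ x, x ≠ z → x < z) ∧ G.graph = SimpleGraph.starGraph z

/-- A monotone path: a path `u_1 ⋯ u_n`, `n ≥ 1`, with `u_1 < ⋯ < u_n`. -/
def IsMonotonePath (G : OrderedGraph.{u}) : Prop :=
  ∃ n : ℕ, 1 ≤ n ∧ ∃ p : Fin n ≃o G.V,
    ∀ i j, G.graph.Adj (p i) (p j) ↔ (SimpleGraph.pathGraph n).Adj i j

/-- A connected component of `G` as an ordered graph. -/
abbrev component (G : OrderedGraph.{u}) (C : G.graph.ConnectedComponent) : OrderedGraph.{u} where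
  V := C.supp
  graph := G.graph.induce C.supp

/-- Each component of `G` is a right star. -/
def IsRightStarForest (G : OrderedGraph.{u}) : Prop :=
  ∀ C, (G.component C).IsRightStar

/-- Each component of `G` is a left star. -/
def IsLeftStarForest (G : OrderedGraph.{u}) : Prop :=
  ∀ C, (G.component C).IsLeftStar

/-- Each component of `G` is a left star or a right star. -/
def IsLeftRightStarForest (G : OrderedGraph.{u}) : Prop :=
  ∀ C, (G.component C).IsLeftStar ∨ (G.component C).IsRightStar

/-- Each component of `G` is a monotone path. -/
def IsMonotonePathForest (G : OrderedGraph.{u}) : Prop :=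
  ∀ C, (G.component C).IsMonotonePath

/-- Each vertex of `G` has at most one neighbor to the left. -/
def AtMostOneLeftNeighbor (G : OrderedGraph.{u}) : Prop :=
  ∀ x : G.V, {y | y < x ∧ G.graph.Adj x y}.Subsingleton

/-- Each vertex of `G` has at most one neighbor to the right. -/
def AtMostOneRightNeighbor (G : OrderedGraph.{u}) : Prop :=
  ∀ x : G.V, {y | x < y ∧ G.graph.Adj x y}.Subsingleton

/-- Both `H` and `H'` are forests and one of the following holds: one of them is a partial
matching; one is a forest of right stars and in the other each vertex has at most one neighbor to
the left; one is a forest of left stars and in the other each vertex has at most one neighbor to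
the right; one is a forest of left and right stars and the other a forest of monotone paths. -/
def ForestCondition (H : OrderedGraph.{v}) (H' : OrderedGraph.{w}) : Prop :=
  (H.IsForest ∧ H'.IsForest) ∧
    ((H.IsPartialMatching ∨ H'.IsPartialMatching) ∨
     ((H.IsRightStarForest ∧ H'.AtMostOneLeftNeighbor) ∨
      (H'.IsRightStarForest ∧ H.AtMostOneLeftNeighbor)) ∨
     ((H.IsLeftStarForest ∧ H'.AtMostOneRightNeighbor) ∨
      (H'.IsLeftStarForest ∧ H.AtMostOneRightNeighbor)) ∨
     ((H.IsLeftRightStarForest ∧ H'.IsMonotonePathForest) ∨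
      (H'.IsLeftRightStarForest ∧ H.IsMonotonePathForest)))

end OrderedGraph

/-!
The density of an ordered graph is less than `1` if and only if it is a forest: a cycle has as many
edges as vertices, and in a forest each edge joins a vertex to its parent. So it remains to compare
forests in `R_<(H, H')` with the conditions on `H` and `H'`. Forests are handled by means of rank
functions (`SimpleGraph.IsForestRank`), which turn them into rooted forests.

*Necessity.* Every forest has three edge-colorings, defined in terms of parents:
* one without a red vertex with two left neighbors and without a blue vertex with two right
  neighbors (`IsRamsey.atMostOneNeighbor`);
* one without a monochromatic monotone path on three vertices (`IsRamsey.monotoneFree`);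
* one without a red path `abcd` that turns at `b` and at `c`, and without a blue monotone path on
  three vertices (`IsRamsey.zigzagFree_or_monotoneFree`).

If a forest is a Ramsey graph of `(H, H')`, then in each case `H` or `H'` avoids the pattern of its
color, also after interchanging the colors. The resulting combinations of avoided patterns are
exactly the conditions of the theorem (`IsRamsey.forestCondition`).

*Sufficiency, matchings.* If `H'` is a partial matching, take a disjoint union of copies of `H`, one
for each choice of positions of its vertices among `N` positions. Without a red `H`, each copy has a
blue edge; by Ramsey's theorem it may be assumed to join the same two vertices of `H` in all copies,
and then the blue edges of suitable copies form `H'` (`exists_isRamsey_copies`). This union is a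
forest if `H` is, and a partial matching if `H` is.

*Sufficiency, stars.* If the components of `H` are stars, then the vertices of `H` are replaced by
blocks, each of which holds a Ramsey graph for `H` and the graph `H'` without its last vertex (for
right stars) or its first vertex (for left stars), and all vertices get a leaf in every block. A
blue edge to a leaf completes a blue `H'`, and otherwise the red edges to leaves contain `H`
(`isRamsey_leafBlocks`). The conditions on left and right neighbors in `H'` ensure that the removed
vertex has at most one neighbor.
-/

/-! ### Forests and rank functions -/

/-- `r` ranks the vertices of `G`: adjacent vertices have different ranks, and each vertex has at
most one neighbor of smaller rank, its parent. -/
structure SimpleGraph.IsForestRank {V : Type*} (G : SimpleGraph V) (r : V → ℕ) : Prop where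
  ne_of_adj : ∀ {x y}, G.Adj x y → r x ≠ r y
  eq_of_lt : ∀ {x y z}, G.Adj x y → G.Adj x z → r y < r x → r z < r x → y = z

namespace SimpleGraph

variable {V : Type*} {G : SimpleGraph V} {r : V → ℕ}

/-- The two neighbors on a cycle of a vertex of maximum rank would both be parents. -/
theorem IsForestRank.isAcyclic (h : G.IsForestRank r) : G.IsAcyclic := by
  classical
  intro v c hc
  obtain ⟨x, hx, hmax⟩ := c.support.toFinset.exists_max_image r ⟨v, by simp⟩
  have hx' : x ∈ c.support := by simpa using hx
  have hc' := hc.rotate hx'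
  have hlt : ∀ y ∈ (c.rotate x hx').support, G.Adj x y → r y < r x := by
    intro y hy hxy
    refine lt_of_le_of_ne (hmax y ?_) (h.ne_of_adj hxy).symm
    simpa using (Walk.mem_support_rotate_iff c x hx').1 hy
  have h1 := Walk.adj_snd hc'.not_nil
  have h2 := (Walk.adj_penultimate hc'.not_nil).symm
  exact hc'.snd_ne_penultimate (h.eq_of_lt h1 h2 (hlt _ (Walk.getVert_mem_support ..) h1)
    (hlt _ (Walk.getVert_mem_support ..) h2))

/-- The distance from a root chosen in each component is a rank function. -/
theorem IsAcyclic.exists_isForestRank (h : G.IsAcyclic) : ∃ r, G.IsForestRank r := by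
  classical
  let root : V → V := fun x ↦ (G.connectedComponentMk x).out
  have hroot : ∀ x, G.Reachable (root x) x := fun x ↦
    ConnectedComponent.exact (Quot.out_eq (G.connectedComponentMk x))
  have hadj : ∀ {x y}, G.Adj x y → root x = root y := fun hxy ↦ by
    simp only [root, ConnectedComponent.connectedComponentMk_eq_of_adj hxy]
  refine ⟨fun x ↦ G.dist (root x) x, fun {x y} hxy ↦ ?_, ?_⟩
  · simpa only [← hadj hxy] using h.dist_ne_of_adj hxy (hroot x)
  · intro x y z hxy hxz hy hz
    obtain ⟨p, hp, hp'⟩ := (hroot x).exists_path_of_dist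
    -- The parent lies on the path from the root: otherwise that path followed by the edge to it
    -- would be the path to a vertex that is closer to the root.
    have key : ∀ {y}, G.Adj x y → G.dist (root y) y < G.dist (root x) x → y = p.penultimate := by
      intro y hxy hy
      refine h.eq_penultimate_of_adj_end hp hxy ?_
      by_contra hmem
      obtain ⟨q, hq, hq'⟩ := ((hroot x).trans hxy.reachable).exists_path_of_dist
      have hmem' := h.mem_support_of_ne_mem_support_of_adj_of_isPath hq hp hxy.symm hmem
      have hlen := congrArg Walk.length (h.path_concat hp hq hxy hmem')
      rw [Walk.length_concat] at hlen
      rw [← hadj hxy] at hy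
      omega
    rw [key hxy hy, key hxz hz]

end SimpleGraph

/-! ### Density -/

namespace SimpleGraph

variable {V : Type*} {G : SimpleGraph V}

/-- Each edge joins a vertex of its subgraph to its parent, and a vertex of minimum rank has no
parent. -/
theorem IsAcyclic.ncard_edgeSet_lt_ncard_verts [Finite V] (h : G.IsAcyclic) (G' : G.Subgraph)
    (hne : G'.verts.Nonempty) : G'.edgeSet.ncard < G'.verts.ncard := by
  classical
  obtain ⟨r, hr⟩ := h.exists_isForestRank
  obtain ⟨v₀, hv₀, hmin⟩ := Set.exists_min_image G'.verts r (Set.toFinite _) hne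
  let par : V → V := fun x ↦ if hx : ∃ y, G.Adj x y ∧ r y < r x then hx.choose else x
  have hpar : ∀ {x y}, G.Adj x y → r y < r x → par x = y := by
    intro x y hxy hlt
    have hx : ∃ y, G.Adj x y ∧ r y < r x := ⟨y, hxy, hlt⟩
    simp only [par, dif_pos hx]
    exact hr.eq_of_lt hx.choose_spec.1 hxy hx.choose_spec.2 hlt
  have hsub : G'.edgeSet ⊆ (fun x ↦ s(x, par x)) '' (G'.verts \ {v₀}) := by
    intro e he
    induction e with
    | _ x y =>
      have hxy : G'.Adj x y := by simpa using he
      rcases lt_or_gt_of_ne (hr.ne_of_adj hxy.adj_sub) with hlt | hlt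
      · refine ⟨y, ⟨hxy.snd_mem, ?_⟩, ?_⟩
        · rintro rfl
          exact absurd (hmin x hxy.fst_mem) (by omega)
        · simp only [hpar hxy.adj_sub.symm hlt]
          exact Sym2.eq_swap
      · refine ⟨x, ⟨hxy.fst_mem, ?_⟩, ?_⟩
        · rintro rfl
          exact absurd (hmin y hxy.snd_mem) (by omega)
        · simp only [hpar hxy.adj_sub hlt]
  calc G'.edgeSet.ncard ≤ _ := Set.ncard_le_ncard hsub (Set.toFinite _)
    _ ≤ (G'.verts \ {v₀}).ncard := Set.ncard_image_le (Set.toFinite _)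
    _ < G'.verts.ncard := Set.ncard_sdiff_singleton_lt_of_mem hv₀ (Set.toFinite _)

theorem Walk.IsCycle.ncard_verts_le_ncard_edgeSet {v : V} {c : G.Walk v v} (hc : c.IsCycle) :
    c.toSubgraph.verts.ncard ≤ c.toSubgraph.edgeSet.ncard := by
  classical
  have hv : c.toSubgraph.verts = ↑(c.support.tail.toFinset) := by
    ext x
    rw [Walk.mem_verts_toSubgraph]
    simp only [List.coe_toFinset, Set.mem_ofPred_eq]
    refine ⟨fun hx ↦ ?_, List.mem_of_mem_tail⟩
    rw [Walk.mem_support_iff] at hx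
    rcases hx with rfl | hx
    · exact Walk.end_mem_tail_support hc.not_nil
    · exact hx
  have he : c.toSubgraph.edgeSet = ↑(c.edges.toFinset) := by
    ext e
    simp
  rw [hv, he, Set.ncard_coe_finset, Set.ncard_coe_finset,
    List.toFinset_card_of_nodup hc.isTrail.edges_nodup]
  refine (List.toFinset_card_le _).trans ?_
  simp

end SimpleGraph

namespace OrderedGraph

theorem IsForest.density_lt_one {F : OrderedGraph.{u}} (h : F.IsForest) : F.density < 1 := by
  obtain ⟨G', hG'⟩ := exists_eq_ciSup_of_finite (f := fun G' : F.graph.Subgraph ↦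
    ⨆ (_ : G'.verts.Nonempty), (G'.edgeSet.ncard : ℝ≥0∞) / (G'.verts.ncard : ℝ≥0∞))
  rw [density, ← hG']
  by_cases hne : G'.verts.Nonempty
  · have hlt := SimpleGraph.IsAcyclic.ncard_edgeSet_lt_ncard_verts h G' hne
    simp only [hne, iSup_pos]
    rw [ENNReal.div_lt_iff (Or.inl (by simp; omega)) (Or.inl (by simp)), one_mul]
    exact_mod_cast hlt
  · simp [hne]

theorem isForest_of_density_lt_one {F : OrderedGraph.{u}} (h : F.density < 1) : F.IsForest := by
  intro v c hc
  refine absurd h (not_lt.2 ?_)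
  have hne : c.toSubgraph.verts.Nonempty := ⟨v, c.start_mem_verts_toSubgraph⟩
  refine le_trans ?_ (le_iSup₂_of_le c.toSubgraph hne le_rfl)
  have hpos : 0 < c.toSubgraph.verts.ncard := (Set.ncard_pos (Set.toFinite _)).2 hne
  rw [ENNReal.le_div_iff_mul_le (Or.inl (by simp)) (Or.inl (by simp)), one_mul]
  exact_mod_cast hc.ncard_verts_le_ncard_edgeSet

theorem ramseyDensity_lt_one_iff {H : OrderedGraph.{v}} {H' : OrderedGraph.{w}} :
    ramseyDensity H H' < 1 ↔ ∃ F ∈ ramseyGraphs H H', F.IsForest := by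
  simp only [ramseyDensity, iInf_lt_iff, exists_prop]
  exact exists_congr fun F ↦ and_congr_right fun _ ↦
    ⟨isForest_of_density_lt_one, IsForest.density_lt_one⟩

end OrderedGraph

/-! ### Ramsey graphs -/

namespace OrderedGraph

/-- The ordered graph on the vertices of `F` with edge set replaced by that of `A`. -/
abbrev withGraph (F : OrderedGraph.{u}) (A : SimpleGraph F.V) : OrderedGraph.{u} where
  V := F.V
  graph := A

/-- An edge-coloring may be given by two graphs `A` (red) and `B` (blue) that together cover the
edges of `F`; edges outside `F` and edges in both graphs do no harm. -/
theorem isRamsey_iff {F : OrderedGraph.{u}} {H : OrderedGraph.{v}} {H' : OrderedGraph.{w}} :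
    F.IsRamsey H H' ↔ ∀ A B : SimpleGraph F.V, F.graph ≤ A ⊔ B →
      (F.withGraph A).ContainsCopy H ∨ (F.withGraph B).ContainsCopy H' := by
  classical
  constructor
  · intro h A B hAB
    refine (h fun e ↦ if e.1 ∈ A.edgeSet then Color.red else Color.blue).imp ?_ ?_
    · rintro ⟨f, hf, hadj⟩
      refine ⟨f, hf, fun a b hab ↦ ?_⟩
      obtain ⟨⟨he, hc⟩, -⟩ := (SimpleGraph.fromEdgeSet_adj _).1 (hadj a b hab)
      by_contra hn
      simp [show ¬ A.Adj (f a) (f b) from hn] at hc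
    · rintro ⟨f, hf, hadj⟩
      refine ⟨f, hf, fun a b hab ↦ ?_⟩
      obtain ⟨⟨he, hc⟩, -⟩ := (SimpleGraph.fromEdgeSet_adj _).1 (hadj a b hab)
      refine (hAB he).resolve_left fun hn ↦ ?_
      simp [show A.Adj (f a) (f b) from hn] at hc
  · intro h c
    refine h _ _ fun x y hxy ↦ ?_
    have hne := hxy.ne
    cases hc : c ⟨s(x, y), hxy⟩ with
    | red => exact Or.inl ((SimpleGraph.fromEdgeSet_adj _).2 ⟨⟨hxy, hc⟩, hne⟩)
    | blue => exact Or.inr ((SimpleGraph.fromEdgeSet_adj _).2 ⟨⟨hxy, hc⟩, hne⟩)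

theorem IsRamsey.symm {F : OrderedGraph.{u}} {H : OrderedGraph.{v}} {H' : OrderedGraph.{w}}
    (h : F.IsRamsey H H') : F.IsRamsey H' H := by
  rw [isRamsey_iff] at h ⊢
  exact fun A B hAB ↦ (h B A (sup_comm A B ▸ hAB)).symm

theorem ContainsCopy.isForest {G : OrderedGraph.{u}} {H : OrderedGraph.{v}}
    (h : G.ContainsCopy H) (hG : G.IsForest) : H.IsForest := by
  obtain ⟨f, hf, hadj⟩ := h
  exact SimpleGraph.IsAcyclic.comap ⟨f, fun {a b} hab ↦ hadj a b hab⟩ hf.injective hG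

/-- Color all edges red. -/
theorem IsRamsey.containsCopy_left {F : OrderedGraph.{u}} {H : OrderedGraph.{v}}
    {H' : OrderedGraph.{w}} (h : F.IsRamsey H H') (hH' : H'.graph.edgeSet.Nonempty) :
    F.ContainsCopy H := by
  refine (isRamsey_iff.1 h F.graph ⊥ le_sup_left).resolve_right ?_
  rintro ⟨f, -, hadj⟩
  obtain ⟨e, he⟩ := hH'
  induction e with
  | _ x y => exact hadj x y he

/-! ### Avoided patterns -/

theorem isPartialMatching_iff {G : OrderedGraph.{u}} :
    G.IsPartialMatching ↔ ∀ x y z, G.graph.Adj x y → G.graph.Adj x z → y = z := by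
  constructor
  · intro h x y z hxy hxz
    by_contra hne
    refine h ⟨⟨⟨![y, x, z], ?_⟩, ?_⟩⟩
    · intro i j hij
      rw [SimpleGraph.pathGraph_adj] at hij
      fin_cases i <;> fin_cases j <;> simp_all [SimpleGraph.adj_comm]
    · intro i j hij
      have h1 := hxy.ne
      have h2 := hxz.ne
      fin_cases i <;> fin_cases j <;> simp_all
  · rintro h ⟨f⟩
    have hadj : ∀ i j, (SimpleGraph.pathGraph 3).Adj i j → G.graph.Adj (f i) (f j) :=
      fun i j hij ↦ f.toHom.map_adj hij
    have := h (f 1) (f 0) (f 2) (hadj _ _ (by simp [SimpleGraph.pathGraph_adj]))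
      (hadj _ _ (by simp [SimpleGraph.pathGraph_adj]))
    exact absurd (f.injective this) (by decide)

theorem ContainsCopy.isPartialMatching {G : OrderedGraph.{u}} {H : OrderedGraph.{v}}
    (h : G.ContainsCopy H) (hG : G.IsPartialMatching) : H.IsPartialMatching := by
  obtain ⟨f, hf, hadj⟩ := h
  rw [isPartialMatching_iff] at hG ⊢
  exact fun x y z hxy hxz ↦ hf.injective (hG _ _ _ (hadj _ _ hxy) (hadj _ _ hxz))

theorem ContainsCopy.atMostOneLeftNeighbor {G : OrderedGraph.{u}} {H : OrderedGraph.{v}}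
    (h : G.ContainsCopy H) (hG : G.AtMostOneLeftNeighbor) : H.AtMostOneLeftNeighbor := by
  obtain ⟨f, hf, hadj⟩ := h
  exact fun x y hy z hz ↦ hf.injective
    (hG (f x) ⟨hf hy.1, hadj _ _ hy.2⟩ ⟨hf hz.1, hadj _ _ hz.2⟩)

theorem ContainsCopy.atMostOneRightNeighbor {G : OrderedGraph.{u}} {H : OrderedGraph.{v}}
    (h : G.ContainsCopy H) (hG : G.AtMostOneRightNeighbor) : H.AtMostOneRightNeighbor := by
  obtain ⟨f, hf, hadj⟩ := h
  exact fun x y hy z hz ↦ hf.injective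
    (hG (f x) ⟨hf hy.1, hadj _ _ hy.2⟩ ⟨hf hz.1, hadj _ _ hz.2⟩)

/-- `G` has no monotone path on three vertices. -/
def MonotoneFree (G : OrderedGraph.{u}) : Prop :=
  ∀ ⦃x y z⦄, x < y → y < z → G.graph.Adj x y → ¬ G.graph.Adj y z

/-- `G` has no path `abcd` that changes its direction at `b` and at `c`. -/
def ZigzagFree (G : OrderedGraph.{u}) : Prop :=
  ∀ ⦃a b c d⦄, b < a → b < c → d < c → a ≠ c → b ≠ d →
    G.graph.Adj b a → G.graph.Adj b c → ¬ G.graph.Adj d c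

theorem ContainsCopy.monotoneFree {G : OrderedGraph.{u}} {H : OrderedGraph.{v}}
    (h : G.ContainsCopy H) (hG : G.MonotoneFree) : H.MonotoneFree := by
  obtain ⟨f, hf, hadj⟩ := h
  exact fun x y z hxy hyz h1 h2 ↦ hG (hf hxy) (hf hyz) (hadj _ _ h1) (hadj _ _ h2)

theorem ContainsCopy.zigzagFree {G : OrderedGraph.{u}} {H : OrderedGraph.{v}}
    (h : G.ContainsCopy H) (hG : G.ZigzagFree) : H.ZigzagFree := by
  obtain ⟨f, hf, hadj⟩ := h
  exact fun a b c d h1 h2 h3 h4 h5 h6 h7 h8 ↦ hG (hf h1) (hf h2) (hf h3) (hf.injective.ne h4)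
    (hf.injective.ne h5) (hadj _ _ h6) (hadj _ _ h7) (hadj _ _ h8)

/-! ### Colorings of forests -/

variable {F : OrderedGraph.{u}} {H : OrderedGraph.{v}} {H' : OrderedGraph.{w}}

/-- Color the edge between a vertex and its parent red if the parent is on the left, and blue
otherwise. -/
theorem IsRamsey.atMostOneNeighbor (h : F.IsRamsey H H') (hF : F.IsForest) :
    H.AtMostOneLeftNeighbor ∨ H'.AtMostOneRightNeighbor := by
  obtain ⟨r, hr⟩ := SimpleGraph.IsAcyclic.exists_isForestRank hF
  let A : SimpleGraph F.V :=
    { Adj := fun x y ↦ F.graph.Adj x y ∧ ((r x < r y ∧ x < y) ∨ (r y < r x ∧ y < x))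
      symm := ⟨fun x y ⟨h1, h2⟩ ↦ ⟨h1.symm, h2.symm⟩⟩
      loopless := ⟨fun x h ↦ h.1.ne rfl⟩ }
  let B : SimpleGraph F.V :=
    { Adj := fun x y ↦ F.graph.Adj x y ∧ ((r x < r y ∧ y < x) ∨ (r y < r x ∧ x < y))
      symm := ⟨fun x y ⟨h1, h2⟩ ↦ ⟨h1.symm, h2.symm⟩⟩
      loopless := ⟨fun x h ↦ h.1.ne rfl⟩ }
  refine (isRamsey_iff.1 h A B ?_).imp (fun hA ↦ hA.atMostOneLeftNeighbor ?_)
    (fun hB ↦ hB.atMostOneRightNeighbor ?_)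
  · intro x y hxy
    have h1 := hr.ne_of_adj hxy
    have h2 := hxy.ne
    rcases lt_or_gt_of_ne h1 with h1 | h1 <;> rcases lt_or_gt_of_ne h2 with h2 | h2 <;>
      simp [A, B, hxy, h1, h2]
  · rintro x y ⟨hy, hxy, hy'⟩ z ⟨hz, hxz, hz'⟩
    exact hr.eq_of_lt hxy hxz (hy'.resolve_left fun h ↦ hy.asymm h.2).1
      (hz'.resolve_left fun h ↦ hz.asymm h.2).1
  · rintro x y ⟨hy, hxy, hy'⟩ z ⟨hz, hxz, hz'⟩
    exact hr.eq_of_lt hxy hxz (hy'.resolve_left fun h ↦ hy.asymm h.2).1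
      (hz'.resolve_left fun h ↦ hz.asymm h.2).1

/-- Color an edge by the class, in a bipartition of the forest, of its left endpoint. -/
theorem IsRamsey.monotoneFree (h : F.IsRamsey H H') (hF : F.IsForest) :
    H.MonotoneFree ∨ H'.MonotoneFree := by
  obtain ⟨col⟩ := SimpleGraph.IsAcyclic.colorable_two hF
  let A : Fin 2 → SimpleGraph F.V := fun i ↦
    { Adj := fun x y ↦ F.graph.Adj x y ∧ ((x < y ∧ col x = i) ∨ (y < x ∧ col y = i))
      symm := ⟨fun x y ⟨h1, h2⟩ ↦ ⟨h1.symm, h2.symm⟩⟩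
      loopless := ⟨fun x h ↦ h.1.ne rfl⟩ }
  have hA : ∀ i, (F.withGraph (A i)).MonotoneFree := by
    rintro i x y z hxy hyz ⟨h1, h2⟩ ⟨h3, h4⟩
    have h5 := (h2.resolve_right fun h ↦ hxy.asymm h.1).2
    have h6 := (h4.resolve_right fun h ↦ hyz.asymm h.1).2
    exact col.valid h1 (h5.trans h6.symm)
  refine (isRamsey_iff.1 h (A 0) (A 1) ?_).imp (fun h ↦ h.monotoneFree (hA 0))
    (fun h ↦ h.monotoneFree (hA 1))
  intro x y hxy
  have hcol : ∀ z, col z = 0 ∨ col z = 1 := fun z ↦ by generalize col z = i; fin_cases i <;> simp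
  rcases lt_or_gt_of_ne hxy.ne with h2 | h2
  · rcases hcol x with h1 | h1 <;> simp [A, hxy, h1, h2]
  · rcases hcol y with h1 | h1 <;> simp [A, hxy, h1, h2]

/-- Color an edge `xy` with `x < y` blue if the parent of `x` is to the right of `x` and `y` has no
parent to its right, and red otherwise. -/
theorem IsRamsey.zigzagFree_or_monotoneFree (h : F.IsRamsey H H') (hF : F.IsForest) :
    H.ZigzagFree ∨ H'.MonotoneFree := by
  classical
  obtain ⟨r, hr⟩ := SimpleGraph.IsAcyclic.exists_isForestRank hF
  let up : F.V → Prop := fun x ↦ ∃ p, F.graph.Adj x p ∧ r p < r x ∧ x < p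
  have not_up : ∀ {x p}, F.graph.Adj x p → r p < r x → p < x → ¬ up x := by
    rintro x p hxp hlt hpx ⟨q, hxq, hlt', hq⟩
    exact (hpx.trans hq).ne (hr.eq_of_lt hxp hxq hlt hlt')
  let P : F.V → F.V → Prop := fun x y ↦ x < y ∧ up x ∧ ¬ up y
  let A : SimpleGraph F.V :=
    { Adj := fun x y ↦ F.graph.Adj x y ∧ ¬ (P x y ∨ P y x)
      symm := ⟨fun x y ⟨h1, h2⟩ ↦ ⟨h1.symm, fun h ↦ h2 h.symm⟩⟩
      loopless := ⟨fun x h ↦ h.1.ne rfl⟩ }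
  let B : SimpleGraph F.V :=
    { Adj := fun x y ↦ F.graph.Adj x y ∧ (P x y ∨ P y x)
      symm := ⟨fun x y ⟨h1, h2⟩ ↦ ⟨h1.symm, h2.symm⟩⟩
      loopless := ⟨fun x h ↦ h.1.ne rfl⟩ }
  refine (isRamsey_iff.1 h A B ?_).imp (fun hA ↦ hA.zigzagFree ?_) (fun hB ↦ hB.monotoneFree ?_)
  · intro x y hxy
    by_cases hP : P x y ∨ P y x
    · exact Or.inr ⟨hxy, hP⟩
    · exact Or.inl ⟨hxy, hP⟩
  · rintro a b c d hba hbc hdc hac hbd ⟨h1, h1'⟩ ⟨h2, -⟩ ⟨h3, h3'⟩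
    have h1' : ¬ P b a := fun h ↦ h1' (Or.inl h)
    have h3' : ¬ P d c := fun h ↦ h3' (Or.inl h)
    rcases lt_or_gt_of_ne (hr.ne_of_adj h2) with hlt | hlt
    · -- `b` is the parent of `c`, and hence `c` is the parent of `d`.
      have hcd : r c < r d := by
        by_contra hn
        have := hr.ne_of_adj h3
        exact hbd (hr.eq_of_lt h2.symm h3.symm hlt (by omega))
      exact h3' ⟨hdc, ⟨c, h3, hcd, hdc⟩, not_up h2.symm hlt hbc⟩
    · -- `c` is the parent of `b`, and hence `b` is the parent of `a`.
      have hba' : r b < r a := by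
        by_contra hn
        have := hr.ne_of_adj h1
        exact hac (hr.eq_of_lt h1 h2 (by omega) hlt)
      exact h1' ⟨hba, ⟨c, h2, hlt, hbc⟩, not_up h1.symm hba' hba⟩
  · rintro x y z hxy hyz ⟨-, h2⟩ ⟨-, h4⟩
    have h5 := h2.resolve_right fun h ↦ hxy.asymm h.1
    have h6 := h4.resolve_right fun h ↦ hyz.asymm h.1
    exact h5.2.2 h6.2.1

end OrderedGraph

/-! ### Components that are stars -/

namespace OrderedGraph

variable {G : OrderedGraph.{u}}

theorem eq_or_adj_of_mem_component {z : G.V}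
    (h : ∀ x, G.graph.Adj z x → ∀ y, G.graph.Adj x y → y = z) {v : G.V}
    (hv : v ∈ (G.graph.connectedComponentMk z).supp) : v = z ∨ G.graph.Adj z v := by
  have hr : G.graph.Reachable z v :=
    (SimpleGraph.ConnectedComponent.exact
      ((SimpleGraph.ConnectedComponent.mem_supp_iff _ _).1 hv)).symm
  rw [SimpleGraph.reachable_iff_reflTransGen] at hr
  induction hr with
  | refl => exact Or.inl rfl
  | @tail b c hb hbc ih =>
    rcases ih ((SimpleGraph.ConnectedComponent.mem_supp_iff _ _).2
      (SimpleGraph.ConnectedComponent.sound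
        ((SimpleGraph.reachable_iff_reflTransGen _ _).2 hb).symm)) with rfl | hz
    · exact Or.inr hbc
    · exact Or.inl (h b hz c hbc)

theorem component_graph_eq_starGraph {z : G.V}
    (h : ∀ x, G.graph.Adj z x → ∀ y, G.graph.Adj x y → y = z) :
    (G.component (G.graph.connectedComponentMk z)).graph = SimpleGraph.starGraph ⟨z, rfl⟩ := by
  ext ⟨x, hx⟩ ⟨y, hy⟩
  rw [SimpleGraph.starGraph_adj]
  change G.graph.Adj x y ↔ _
  constructor
  · intro hxy
    exact ⟨fun h ↦ hxy.ne (congrArg Subtype.val h), (eq_or_adj_of_mem_component h hx).imp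
      Subtype.ext fun hz ↦ Subtype.ext (h x hz y hxy)⟩
  · rintro ⟨hne, hz | hz⟩
    · obtain rfl : x = z := congrArg Subtype.val hz
      exact (eq_or_adj_of_mem_component h hy).resolve_left fun h ↦ hne (Subtype.ext h.symm)
    · obtain rfl : y = z := congrArg Subtype.val hz
      exact ((eq_or_adj_of_mem_component h hx).resolve_left fun h ↦ hne (Subtype.ext h)).symm

theorem isRightStar_component {z : G.V}
    (h : ∀ x, G.graph.Adj z x → z < x ∧ ∀ y, G.graph.Adj x y → y = z) :
    (G.component (G.graph.connectedComponentMk z)).IsRightStar := by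
  refine ⟨⟨z, rfl⟩, ?_, component_graph_eq_starGraph fun x hx ↦ (h x hx).2⟩
  rintro ⟨x, hx⟩ hne
  exact (h x ((eq_or_adj_of_mem_component (fun x hx ↦ (h x hx).2) hx).resolve_left
    fun h ↦ hne (Subtype.ext h))).1

theorem isLeftStar_component {z : G.V}
    (h : ∀ x, G.graph.Adj z x → x < z ∧ ∀ y, G.graph.Adj x y → y = z) :
    (G.component (G.graph.connectedComponentMk z)).IsLeftStar := by
  refine ⟨⟨z, rfl⟩, ?_, component_graph_eq_starGraph fun x hx ↦ (h x hx).2⟩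
  rintro ⟨x, hx⟩ hne
  exact (h x ((eq_or_adj_of_mem_component (fun x hx ↦ (h x hx).2) hx).resolve_left
    fun h ↦ hne (Subtype.ext h))).1

/-- The center of a component is a vertex without neighbors to the left: any vertex of the
component, or else its unique left neighbor. -/
theorem isRightStarForest_of_monotoneFree (hL : G.AtMostOneLeftNeighbor) (hM : G.MonotoneFree) :
    G.IsRightStarForest := by
  have key : ∀ z, (∀ y, y < z → ¬ G.graph.Adj z y) →
      (G.component (G.graph.connectedComponentMk z)).IsRightStar := by
    intro z hz
    refine isRightStar_component fun x hx ↦ ?_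
    have hzx : z < x := lt_of_le_of_ne (not_lt.1 fun h ↦ hz x h hx) hx.ne
    refine ⟨hzx, fun y hxy ↦ ?_⟩
    rcases lt_or_gt_of_ne hxy.ne with hlt | hlt
    · exact absurd hxy (hM hzx hlt hx)
    · exact hL x ⟨hlt, hxy⟩ ⟨hzx, hx.symm⟩
  intro C
  induction C using SimpleGraph.ConnectedComponent.ind with
  | _ v =>
    by_cases hv : ∃ z, z < v ∧ G.graph.Adj v z
    · obtain ⟨z, hzv, hadj⟩ := hv
      rw [SimpleGraph.ConnectedComponent.connectedComponentMk_eq_of_adj hadj]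
      exact key z fun y hyz hy ↦ hM hyz hzv hy.symm hadj.symm
    · push Not at hv
      exact key v hv

theorem isLeftStarForest_of_monotoneFree (hR : G.AtMostOneRightNeighbor) (hM : G.MonotoneFree) :
    G.IsLeftStarForest := by
  have key : ∀ z, (∀ y, z < y → ¬ G.graph.Adj z y) →
      (G.component (G.graph.connectedComponentMk z)).IsLeftStar := by
    intro z hz
    refine isLeftStar_component fun x hx ↦ ?_
    have hzx : x < z := lt_of_le_of_ne (not_lt.1 fun h ↦ hz x h hx) hx.ne.symm
    refine ⟨hzx, fun y hxy ↦ ?_⟩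
    rcases lt_or_gt_of_ne hxy.ne with hlt | hlt
    · exact hR x ⟨hlt, hxy⟩ ⟨hzx, hx.symm⟩
    · exact absurd hx.symm (hM hlt hzx hxy.symm)
  intro C
  induction C using SimpleGraph.ConnectedComponent.ind with
  | _ v =>
    by_cases hv : ∃ z, v < z ∧ G.graph.Adj v z
    · obtain ⟨z, hzv, hadj⟩ := hv
      rw [SimpleGraph.ConnectedComponent.connectedComponentMk_eq_of_adj hadj]
      exact key z fun y hyz hy ↦ hM hzv hyz hadj hy
    · push Not at hv
      exact key v hv

/-- For an edge `bc` with `b < c`, one of the endpoints has no other neighbor, and then the other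
endpoint is the center of a star. -/
theorem isLeftRightStarForest_of_zigzagFree (hM : G.MonotoneFree) (hZ : G.ZigzagFree) :
    G.IsLeftRightStarForest := by
  intro C
  induction C using SimpleGraph.ConnectedComponent.ind with
  | _ v =>
    have key : ∀ b c, b < c → G.graph.Adj b c →
        (G.component (G.graph.connectedComponentMk b)).IsLeftStar ∨
        (G.component (G.graph.connectedComponentMk b)).IsRightStar := by
      intro b c hbc hadj
      have hright : ∀ {x}, G.graph.Adj b x → b < x := fun {x} hx ↦
        lt_of_le_of_ne (not_lt.1 fun hxb ↦ hM hxb hbc hx.symm hadj) hx.ne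
      have hleft : ∀ {x}, G.graph.Adj c x → x < c := fun {x} hx ↦
        lt_of_le_of_ne (not_lt.1 fun hcx ↦ hM hbc hcx hadj hx) hx.ne.symm
      by_cases hb : ∃ a, a ≠ c ∧ G.graph.Adj b a
      · obtain ⟨a, hac, hba⟩ := hb
        refine Or.inr (isRightStar_component fun x hx ↦ ⟨hright hx, fun y hxy ↦ ?_⟩)
        have hyx : y < x := lt_of_le_of_ne
          (not_lt.1 fun hlt ↦ hM (hright hx) hlt hx hxy) hxy.ne.symm
        by_contra hne
        by_cases hxc : x = c
        · subst hxc
          exact hZ (hright hba) hbc hyx hac (Ne.symm hne) hba hadj hxy.symm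
        · exact hZ hbc (hright hx) hyx (Ne.symm hxc) (Ne.symm hne) hadj hx hxy.symm
      · push Not at hb
        rw [SimpleGraph.ConnectedComponent.connectedComponentMk_eq_of_adj hadj]
        refine Or.inl (isLeftStar_component fun x hx ↦ ⟨hleft hx, fun y hxy ↦ ?_⟩)
        have hxy' : x < y := lt_of_le_of_ne
          (not_lt.1 fun hlt ↦ hM hlt (hleft hx) hxy.symm hx.symm) hxy.ne
        by_contra hne
        by_cases hxb : x = b
        · subst hxb
          exact hb y hne hxy
        · exact hZ hxy' (hleft hx) hbc hne hxb hxy hx.symm hadj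
    by_cases hv : ∃ x, G.graph.Adj v x
    · obtain ⟨x, hx⟩ := hv
      rcases lt_or_gt_of_ne hx.ne with hlt | hlt
      · exact key v x hlt hx
      · rw [SimpleGraph.ConnectedComponent.connectedComponentMk_eq_of_adj hx]
        exact key x v hlt hx.symm
    · push Not at hv
      exact Or.inl (isLeftStar_component fun x hx ↦ absurd hx (hv x))

theorem isPartialMatching_of_atMostOneNeighbor (hL : G.AtMostOneLeftNeighbor)
    (hR : G.AtMostOneRightNeighbor) (hM : G.MonotoneFree) : G.IsPartialMatching := by
  rw [isPartialMatching_iff]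
  intro x y z hxy hxz
  rcases lt_or_gt_of_ne hxy.ne with h1 | h1 <;> rcases lt_or_gt_of_ne hxz.ne with h2 | h2
  · exact hR x ⟨h1, hxy⟩ ⟨h2, hxz⟩
  · exact absurd hxy (hM h2 h1 hxz.symm)
  · exact absurd hxz (hM h1 h2 hxy.symm)
  · exact hL x ⟨h1, hxy⟩ ⟨h2, hxz⟩

/-! ### Components that are monotone paths -/

/-- Two vertices of a component are joined by a monotone path. -/
theorem reflTransGen_of_reachable (hL : G.AtMostOneLeftNeighbor) (hR : G.AtMostOneRightNeighbor)
    {x y : G.V} (h : G.graph.Reachable x y) :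
    Relation.ReflTransGen (fun a b ↦ a < b ∧ G.graph.Adj a b) x y ∨
      Relation.ReflTransGen (fun a b ↦ a < b ∧ G.graph.Adj a b) y x := by
  rw [SimpleGraph.reachable_iff_reflTransGen] at h
  induction h with
  | refl => exact Or.inl .refl
  | @tail b c hb hbc ih =>
    rcases lt_or_gt_of_ne hbc.ne with hlt | hlt
    · rcases ih with ih | ih
      · exact Or.inl (ih.tail ⟨hlt, hbc⟩)
      · rcases ih.cases_head with rfl | ⟨d, ⟨hbd, hadj⟩, hd⟩
        · exact Or.inl (.single ⟨hlt, hbc⟩)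
        · rw [hR b ⟨hlt, hbc⟩ ⟨hbd, hadj⟩]
          exact Or.inr hd
    · rcases ih with ih | ih
      · rcases ih.cases_tail with rfl | ⟨d, hd, ⟨hdb, hadj⟩⟩
        · exact Or.inr (.single ⟨hlt, hbc.symm⟩)
        · rw [hL b ⟨hlt, hbc⟩ ⟨hdb, hadj.symm⟩]
          exact Or.inl hd
      · exact Or.inr (ih.head ⟨hlt, hbc.symm⟩)

/-- A vertex has a right neighbor that does not lie beyond any given later vertex of its
component. -/
theorem exists_adj_of_reachable (hL : G.AtMostOneLeftNeighbor) (hR : G.AtMostOneRightNeighbor)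
    {x y : G.V} (h : G.graph.Reachable x y) (hxy : x < y) :
    ∃ z, x < z ∧ z ≤ y ∧ G.graph.Adj x z := by
  have hle : ∀ {a b : G.V}, Relation.ReflTransGen (fun a b ↦ a < b ∧ G.graph.Adj a b) a b →
      a ≤ b := by
    intro a b hab
    induction hab with
    | refl => exact le_rfl
    | tail _ h ih => exact ih.trans h.1.le
  have h' := (reflTransGen_of_reachable hL hR h).resolve_right fun h ↦ (hle h).not_gt hxy
  rcases h'.cases_head with rfl | ⟨d, ⟨hxd, hadj⟩, hd⟩
  · exact absurd hxy (lt_irrefl _)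
  · exact ⟨d, hxd, hle hd, hadj⟩

theorem isMonotonePathForest_of_atMostOneNeighbor (hL : G.AtMostOneLeftNeighbor)
    (hR : G.AtMostOneRightNeighbor) : G.IsMonotonePathForest := by
  intro C
  have hreach : ∀ x y : C.supp, G.graph.Reachable x y := fun x y ↦
    SimpleGraph.ConnectedComponent.exact (x.2.trans y.2.symm)
  let : Fintype C.supp := Fintype.ofFinite _
  have : Nonempty C.supp := C.nonempty_supp.to_subtype
  let p : Fin (Fintype.card C.supp) ≃o C.supp := Fintype.orderIsoFinOfCardEq _ rfl
  -- Adjacent vertices of a component are exactly its pairs of consecutive vertices.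
  have key : ∀ i j : Fin (Fintype.card C.supp), i < j →
      (G.graph.Adj (p i) (p j) ↔ i.1 + 1 = j.1) := by
    intro i j hij
    have hlt : ((p i : C.supp) : G.V) < p j := p.lt_iff_lt.2 hij
    constructor
    · intro hadj
      by_contra hne
      have hij' : i.1 < j.1 := hij
      let k : Fin (Fintype.card C.supp) := ⟨i.1 + 1, by omega⟩
      have hik : ((p i : C.supp) : G.V) < p k := p.lt_iff_lt.2 (Fin.lt_def.2 (by simp [k]))
      have hkj : ((p k : C.supp) : G.V) < p j :=
        p.lt_iff_lt.2 (Fin.lt_def.2 (by simp only [k]; omega))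
      obtain ⟨z, hz, hzk, hadj'⟩ := exists_adj_of_reachable hL hR (hreach (p i) (p k)) hik
      have := hR _ ⟨hz, hadj'⟩ ⟨hlt, hadj⟩
      exact (hzk.trans_lt hkj).ne this
    · intro h
      obtain ⟨z, hz, hzj, hadj⟩ := exists_adj_of_reachable hL hR (hreach (p i) (p j)) hlt
      have hzC : z ∈ C.supp := by
        rw [SimpleGraph.ConnectedComponent.mem_supp_iff,
          ← SimpleGraph.ConnectedComponent.connectedComponentMk_eq_of_adj hadj]
        exact (p i).2
      obtain ⟨k, hk⟩ := p.surjective ⟨z, hzC⟩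
      have hkz : ((p k : C.supp) : G.V) = z := congrArg Subtype.val hk
      rw [← hkz] at hz hzj hadj
      have h1 : i < k := p.lt_iff_lt.1 hz
      have h2 : k ≤ j := p.le_iff_le.1 hzj
      have h3 : k = j := by
        rw [Fin.lt_def] at h1
        rw [Fin.le_def] at h2
        exact Fin.ext (by omega)
      rwa [h3] at hadj
  refine ⟨Fintype.card C.supp, Fintype.card_pos, p, fun i j ↦ ?_⟩
  rw [SimpleGraph.pathGraph_adj]
  change G.graph.Adj (p i) (p j) ↔ _
  rcases lt_trichotomy i j with h | rfl | h
  · rw [key i j h]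
    have := Fin.lt_def.1 h
    omega
  · simp
  · rw [G.graph.adj_comm, key j i h]
    have := Fin.lt_def.1 h
    omega

theorem IsMonotonePathForest.exists_path (h : G.IsMonotonePathForest) (x : G.V) :
    ∃ n, ∃ p : Fin n ≃o (G.graph.connectedComponentMk x).supp, ∀ y : G.V, G.graph.Adj x y →
      ∃ i j, p i = x ∧ p j = y ∧ (i.1 + 1 = j.1 ∨ j.1 + 1 = i.1) := by
  obtain ⟨n, -, p, hp⟩ := h (G.graph.connectedComponentMk x)
  refine ⟨n, p, fun y hxy ↦ ?_⟩
  obtain ⟨i, hi⟩ := p.surjective ⟨x, rfl⟩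
  obtain ⟨j, hj⟩ := p.surjective
    ⟨y, (SimpleGraph.ConnectedComponent.connectedComponentMk_eq_of_adj hxy).symm⟩
  refine ⟨i, j, congrArg Subtype.val hi, congrArg Subtype.val hj,
    SimpleGraph.pathGraph_adj.1 ((hp i j).1 ?_)⟩
  change G.graph.Adj (p i).1 (p j).1
  rwa [hi, hj]

theorem IsMonotonePathForest.atMostOneLeftNeighbor (h : G.IsMonotonePathForest) :
    G.AtMostOneLeftNeighbor := by
  rintro x y ⟨hy, hxy⟩ z ⟨hz, hxz⟩
  obtain ⟨n, p, hp⟩ := h.exists_path x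
  obtain ⟨i, j, hi, hj, hij⟩ := hp y hxy
  obtain ⟨i', k, hi', hk, hik⟩ := hp z hxz
  obtain rfl : i = i' := p.injective (Subtype.ext (hi.trans hi'.symm))
  have h1 : j < i := p.lt_iff_lt.1 (Subtype.coe_lt_coe.1 (by rwa [hi, hj]))
  have h2 : k < i := p.lt_iff_lt.1 (Subtype.coe_lt_coe.1 (by rwa [hi, hk]))
  have h3 : j = k := Fin.ext (by rw [Fin.lt_def] at h1 h2; omega)
  rw [← hj, ← hk, h3]

theorem IsMonotonePathForest.atMostOneRightNeighbor (h : G.IsMonotonePathForest) :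
    G.AtMostOneRightNeighbor := by
  rintro x y ⟨hy, hxy⟩ z ⟨hz, hxz⟩
  obtain ⟨n, p, hp⟩ := h.exists_path x
  obtain ⟨i, j, hi, hj, hij⟩ := hp y hxy
  obtain ⟨i', k, hi', hk, hik⟩ := hp z hxz
  obtain rfl : i = i' := p.injective (Subtype.ext (hi.trans hi'.symm))
  have h1 : i < j := p.lt_iff_lt.1 (Subtype.coe_lt_coe.1 (by rwa [hi, hj]))
  have h2 : i < k := p.lt_iff_lt.1 (Subtype.coe_lt_coe.1 (by rwa [hi, hk]))
  have h3 : j = k := Fin.ext (by rw [Fin.lt_def] at h1 h2; omega)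
  rw [← hj, ← hk, h3]

/-! ### Necessity of the conditions -/

theorem ForestCondition.symm {H : OrderedGraph.{v}} {H' : OrderedGraph.{w}}
    (h : ForestCondition H H') : ForestCondition H' H :=
  ⟨h.1.symm, h.2.imp Or.symm (Or.imp Or.symm (Or.imp Or.symm Or.symm))⟩

theorem IsRamsey.forestCondition_of_monotoneFree {F : OrderedGraph.{u}} {H : OrderedGraph.{v}}
    {H' : OrderedGraph.{w}} (h : F.IsRamsey H H') (hF : F.IsForest)
    (hH : H.graph.edgeSet.Nonempty) (hH' : H'.graph.edgeSet.Nonempty) (hM : H.MonotoneFree) :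
    ForestCondition H H' := by
  refine ⟨⟨(h.containsCopy_left hH').isForest hF, (h.symm.containsCopy_left hH).isForest hF⟩, ?_⟩
  rcases h.atMostOneNeighbor hF with hL | hR' <;>
    rcases h.symm.atMostOneNeighbor hF with hL' | hR
  · exact Or.inr (Or.inl (Or.inl ⟨isRightStarForest_of_monotoneFree hL hM, hL'⟩))
  · exact Or.inl (Or.inl (isPartialMatching_of_atMostOneNeighbor hL hR hM))
  · rcases h.zigzagFree_or_monotoneFree hF with hZ | hM'
    · exact Or.inr (Or.inr (Or.inr (Or.inl ⟨isLeftRightStarForest_of_zigzagFree hM hZ,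
        isMonotonePathForest_of_atMostOneNeighbor hL' hR'⟩)))
    · exact Or.inl (Or.inr (isPartialMatching_of_atMostOneNeighbor hL' hR' hM'))
  · exact Or.inr (Or.inr (Or.inl (Or.inl ⟨isLeftStarForest_of_monotoneFree hR hM, hR'⟩)))

theorem IsRamsey.forestCondition {F : OrderedGraph.{u}} {H : OrderedGraph.{v}}
    {H' : OrderedGraph.{w}} (h : F.IsRamsey H H') (hF : F.IsForest)
    (hH : H.graph.edgeSet.Nonempty) (hH' : H'.graph.edgeSet.Nonempty) :
    ForestCondition H H' :=
  (h.monotoneFree hF).elim (h.forestCondition_of_monotoneFree hF hH hH')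
    fun hM ↦ (h.symm.forestCondition_of_monotoneFree hF hH' hH hM).symm

end OrderedGraph

/-! ### Ramsey's theorem for finite sets -/

namespace Finset

/-- Finite Ramsey theorem, the step from `m` to `m + 1`: a large set has a subset of a given size in
which the color of an `(m + 1)`-set depends on its minimum only. -/
theorem exists_minHomogeneous_subset {C : Type} {m : ℕ}
    (ih : ∀ L : ℕ, ∃ N : ℕ, ∀ (α : Type) [LinearOrder α] (S : Finset α), N ≤ S.card →
      ∀ c : Finset α → C, ∃ T ⊆ S, T.card = L ∧ ∃ k, ∀ X ⊆ T, X.card = m → c X = k) (q : ℕ) :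
    ∃ N : ℕ, ∀ (α : Type) [LinearOrder α] (S : Finset α), N ≤ S.card → ∀ c : Finset α → C,
      ∃ T ⊆ S, T.card = q ∧ ∃ d : α → C, ∀ x ∈ T, ∀ Y ⊆ T, (∀ y ∈ Y, x < y) → Y.card = m →
        c (insert x Y) = d x := by
  induction q with
  | zero =>
    refine ⟨0, fun α _ S _ c ↦ ⟨∅, by simp, rfl, fun x ↦ c {x}, by simp⟩⟩
  | succ q ihq =>
    obtain ⟨N, hN⟩ := ihq
    obtain ⟨M, hM⟩ := ih N
    refine ⟨M + 1, fun α _ S hS c ↦ ?_⟩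
    have hne : S.Nonempty := card_pos.1 (by omega)
    set x := S.min' hne with hx
    have hxS : x ∈ S := S.min'_mem hne
    obtain ⟨T, hTS, hT, k, hk⟩ := hM α (S.erase x) (by rw [card_erase_of_mem hxS]; omega)
      fun Y ↦ c (insert x Y)
    obtain ⟨U, hUT, hU, d, hd⟩ := hN α T hT.ge c
    have hUS : U ⊆ S.erase x := hUT.trans hTS
    have hxU : x ∉ U := fun h ↦ notMem_erase x S (hUS h)
    refine ⟨insert x U, insert_subset hxS (hUS.trans (erase_subset _ _)), by
      rw [card_insert_of_notMem hxU, hU], fun y ↦ if y = x then k else d y, ?_⟩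
    intro y hy Y hY hlt hcard
    have hmin : ∀ z ∈ insert x U, x ≤ z := fun z hz ↦ S.min'_le z
      (insert_subset hxS (hUS.trans (erase_subset _ _)) hz)
    have hYU : Y ⊆ U := fun z hz ↦ (mem_insert.1 (hY hz)).resolve_left fun h ↦
      ((hmin y hy).trans_lt (hlt z hz)).ne h.symm
    by_cases hyx : y = x
    · simp only [hyx, if_true]
      exact hk Y (hYU.trans hUT) hcard
    · simp only [if_neg hyx]
      exact hd y ((mem_insert.1 hy).resolve_left hyx) Y hYU hlt hcard

/-- Finite Ramsey theorem for `m`-sets and finitely many colors. -/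
theorem exists_homogeneous_subset {C : Type} [Finite C] (m L : ℕ) :
    ∃ N : ℕ, ∀ (α : Type) [LinearOrder α] (S : Finset α), N ≤ S.card → ∀ c : Finset α → C,
      ∃ T ⊆ S, T.card = L ∧ ∃ k, ∀ X ⊆ T, X.card = m → c X = k := by
  classical
  induction m generalizing L with
  | zero =>
    refine ⟨L, fun α _ S hS c ↦ ?_⟩
    obtain ⟨T, hTS, hT⟩ := exists_subset_card_eq hS
    exact ⟨T, hTS, hT, c ∅, fun X _ hX ↦ by rw [card_eq_zero.1 hX]⟩
  | succ m ih =>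
    have := Fintype.ofFinite C
    obtain ⟨N, hN⟩ := exists_minHomogeneous_subset ih (Fintype.card C * L + 1)
    refine ⟨N, fun α _ S hS c ↦ ?_⟩
    obtain ⟨T, hTS, hT, d, hd⟩ := hN α S hS c
    obtain ⟨k, -, hk⟩ := exists_lt_card_fiber_of_mul_lt_card_of_maps_to
      (s := T) (t := (univ : Finset C)) (f := d) (n := L) (fun _ _ ↦ mem_univ _)
      (by rw [hT, card_univ]; omega)
    obtain ⟨U, hU, hUL⟩ := exists_subset_card_eq hk.le
    refine ⟨U, hU.trans ((filter_subset _ _).trans hTS), hUL, k, fun X hX hcard ↦ ?_⟩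
    have hne : X.Nonempty := card_pos.1 (by omega)
    have hmem := mem_filter.1 (hU (hX (X.min'_mem hne)))
    rw [← insert_erase (X.min'_mem hne), hd _ hmem.1, hmem.2]
    · exact fun y hy ↦ (mem_filter.1 (hU (hX (mem_of_mem_erase hy)))).1
    · exact fun y hy ↦ X.min'_lt_of_mem_erase_min' hne hy
    · rw [card_erase_of_mem (X.min'_mem hne), hcard]
      rfl

/-- The finite Ramsey theorem in terms of increasing maps. -/
theorem exists_homogeneous_orderEmbedding {C : Type} [Finite C] [Nonempty C] (m L : ℕ) :
    ∃ N : ℕ, ∀ c : (Fin m ↪o Fin N) → C, ∃ (t : Fin L ↪o Fin N) (k : C),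
      ∀ φ : Fin m ↪o Fin L, c (φ.trans t) = k := by
  classical
  obtain ⟨N, hN⟩ := exists_homogeneous_subset (C := C) m L
  refine ⟨N, fun c ↦ ?_⟩
  obtain ⟨T, -, hT, k, hk⟩ := hN (Fin N) univ (by simp) fun X ↦
    if h : X.card = m then c (X.orderEmbOfFin h) else Classical.arbitrary C
  refine ⟨T.orderEmbOfFin hT, k, fun φ ↦ ?_⟩
  set ψ := φ.trans (T.orderEmbOfFin hT) with hψ
  have hcard : (univ.map ψ.toEmbedding).card = m := by simp
  have h := hk (univ.map ψ.toEmbedding) ?_ hcard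
  · rw [dif_pos hcard] at h
    rw [← h]
    congr 1
    exact orderEmbOfFin_unique' hcard fun x ↦ mem_map_of_mem _ (mem_univ x)
  · intro x hx
    obtain ⟨i, -, rfl⟩ := mem_map.1 hx
    exact orderEmbOfFin_mem T hT _

end Finset

/-! ### Ramsey graphs for partial matchings -/

namespace OrderedGraph

/-- The graph `G` as an ordered graph, with a linear order of the vertices that refines their
positions `pos`. -/
noncomputable def ofPos {V : Type} [Finite V] {α : Type*} [LinearOrder α] (G : SimpleGraph V)
    (pos : V → α) : OrderedGraph.{0} where
  V := V
  order := LinearOrder.lift' (fun x ↦ toLex (pos x, Finite.equivFin V x)) fun _ _ h ↦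
    (Finite.equivFin V).injective (congrArg Prod.snd (toLex.injective h))
  graph := G

theorem ofPos_lt {V : Type} [Finite V] {α : Type*} [LinearOrder α] (G : SimpleGraph V)
    (pos : V → α) {x y : V} (h : pos x < pos y) : (ofPos G pos).order.lt x y :=
  Prod.Lex.toLex_lt_toLex.2 (Or.inl h)

/-- For `u < v`, an increasing map into `Fin (m * (n + 2))` that takes `h` to `m * (u + 1)` and `h'`
to `m * (v + 1)`. -/
theorem exists_orderEmbedding_of_lt {m n : ℕ} {h h' : Fin m} (hh : h < h') {u v : ℕ} (huv : u < v)
    (hv : v ≤ n) : ∃ φ : Fin m ↪o Fin (m * (n + 2)),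
      (φ h).1 = m * (u + 1) ∧ (φ h').1 = m * (v + 1) := by
  have h1 : m * (u + 1) + m ≤ m * (v + 1) := by
    rw [← Nat.mul_succ]
    exact Nat.mul_le_mul_left m (by omega)
  have h2 : m * (v + 1) + m ≤ m * (n + 2) := by
    rw [← Nat.mul_succ]
    exact Nat.mul_le_mul_left m (by omega)
  have h3 : m ≤ m * (u + 1) := Nat.le_mul_of_pos_right m (by omega)
  have h4 := h.2
  have h5 := h'.2
  have h6 : h.1 < h'.1 := hh
  generalize m * (u + 1) = a at *
  generalize m * (v + 1) = b at *
  refine ⟨OrderEmbedding.ofStrictMono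
    (fun i ↦ ⟨if i.1 < h'.1 then a + i.1 - h.1 else b + i.1 - h'.1, ?_⟩) ?_, ?_, ?_⟩
  · have := i.2
    split_ifs <;> omega
  · intro i j hij
    have h7 : i.1 < j.1 := hij
    have h8 := j.2
    rw [Fin.mk_lt_mk]
    split_ifs <;> omega
  · change (if h.1 < h'.1 then a + h.1 - h.1 else b + h.1 - h'.1) = a
    split_ifs
    omega
  · change (if h'.1 < h'.1 then a + h'.1 - h.1 else b + h'.1 - h'.1) = b
    split_ifs <;> omega

/-- The disjoint union of copies of `G`, one for each increasing map `φ : Fin m ↪o Fin N`. The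
vertex `h` of the copy is placed at position `φ h`. -/
noncomputable def copies {m : ℕ} (G : SimpleGraph (Fin m)) (N : ℕ) : OrderedGraph.{0} :=
  ofPos (V := (Fin m ↪o Fin N) × Fin m)
    { Adj := fun x y ↦ x.1 = y.1 ∧ G.Adj x.2 y.2
      symm := ⟨fun _ _ h ↦ ⟨h.1.symm, h.2.symm⟩⟩
      loopless := ⟨fun _ h ↦ h.2.ne rfl⟩ } fun x ↦ x.1 x.2

theorem isForest_copies {m : ℕ} {G : SimpleGraph (Fin m)} (hG : G.IsAcyclic) (N : ℕ) :
    (copies G N).IsForest := by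
  obtain ⟨r, hr⟩ := hG.exists_isForestRank
  exact SimpleGraph.IsForestRank.isAcyclic (r := fun x : (Fin m ↪o Fin N) × Fin m ↦ r x.2)
    ⟨fun h ↦ hr.ne_of_adj h.2, fun h1 h2 h3 h4 ↦
      Prod.ext (h1.1.symm.trans h2.1) (hr.eq_of_lt h1.2 h2.2 h3 h4)⟩

theorem isPartialMatching_copies {m : ℕ} {G : SimpleGraph (Fin m)}
    (hG : ∀ x y z, G.Adj x y → G.Adj x z → y = z) (N : ℕ) : (copies G N).IsPartialMatching :=
  isPartialMatching_iff.2 fun _ _ _ h1 h2 ↦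
    Prod.ext (h1.1.symm.trans h2.1) (hG _ _ _ h1.2 h2.2)

/-- If there is no red copy of `H`, then each of the copies of `H` in `copies` has a blue edge. By
Ramsey's theorem it is, for all copies placed in a large set of positions, the edge between the same
two vertices `h < h'` of `H`. These copies can be chosen such that the edges `hh'` are placed like
the edges of a given matching. -/
theorem exists_isRamsey_copies {H : OrderedGraph.{v}} {H' : OrderedGraph.{w}}
    (hH : H.graph.edgeSet.Nonempty) (hH' : H'.IsPartialMatching) {m : ℕ} (e : Fin m ≃o H.V) :
    ∃ N, (copies (H.graph.comap e) N).IsRamsey H H' := by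
  classical
  rw [isPartialMatching_iff] at hH'
  obtain ⟨x₀, hx₀⟩ := hH
  have : Nonempty (Fin m) := by
    induction x₀ with
    | _ x y => exact ⟨e.symm x⟩
  let : Fintype H'.V := Fintype.ofFinite _
  set n := Fintype.card H'.V with hn
  let e' : H'.V ≃o Fin n := (Fintype.orderIsoFinOfCardEq H'.V rfl).symm
  obtain ⟨N, hN⟩ := Finset.exists_homogeneous_orderEmbedding (C := Fin m × Fin m) m (m * (n + 2))
  refine ⟨N, isRamsey_iff.2 fun A B hAB ↦ ?_⟩
  by_contra hcon
  rw [not_or] at hcon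
  obtain ⟨hA, hB⟩ := hcon
  have hblue : ∀ φ : Fin m ↪o Fin N, ∃ p : Fin m × Fin m, p.1 < p.2 ∧ B.Adj (φ, p.1) (φ, p.2) := by
    intro φ
    by_contra hno
    push Not at hno
    refine hA ⟨fun x ↦ (φ, e.symm x), fun x y hxy ↦
      ofPos_lt _ _ (φ.lt_iff_lt.2 (e.symm.lt_iff_lt.2 hxy)), fun x y hxy ↦ ?_⟩
    have hF : (copies (H.graph.comap e) N).graph.Adj (φ, e.symm x) (φ, e.symm y) :=
      ⟨rfl, by simpa using hxy⟩
    refine (hAB hF).resolve_right fun hB' ↦ ?_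
    rcases lt_or_gt_of_ne hxy.ne with h | h
    · exact hno (e.symm x, e.symm y) (e.symm.lt_iff_lt.2 h) hB'
    · exact hno (e.symm y, e.symm x) (e.symm.lt_iff_lt.2 h) hB'.symm
  choose c hc using hblue
  obtain ⟨t, ⟨h, h'⟩, ht⟩ := hN c
  have hlt : ∀ φ : Fin m ↪o Fin (m * (n + 2)), h < h' ∧ B.Adj (φ.trans t, h) (φ.trans t, h') :=
    fun φ ↦ by simpa [ht φ] using hc (φ.trans t)
  have hm : 0 < m := h.pos
  -- Some increasing map exists, so that `h < h'`.
  have hh : h < h' := (hlt (Fin.castLEOrderEmb (Nat.le_mul_of_pos_right m (by omega)))).1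
  -- `mate x` is the index of the neighbor of `x`, and `n` if `x` has no neighbor.
  let mate : H'.V → ℕ := fun x ↦ if hx : ∃ y, H'.graph.Adj x y then e' hx.choose else n
  have hmate : ∀ {x y}, H'.graph.Adj x y → mate x = e' y := by
    intro x y hxy
    have hx : ∃ y, H'.graph.Adj x y := ⟨y, hxy⟩
    simp only [mate, dif_pos hx]
    rw [hH' x _ _ hx.choose_spec hxy]
  have hmate_le : ∀ x, mate x ≤ n := by
    intro x
    simp only [mate]
    split_ifs
    · exact (e' _).2.le
    · exact le_rfl
  have hmate_ne : ∀ x, (e' x).1 ≠ mate x := by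
    intro x hx
    by_cases hex : ∃ y, H'.graph.Adj x y
    · obtain ⟨y, hy⟩ := hex
      rw [hmate hy] at hx
      exact hy.ne (e'.injective (Fin.ext hx))
    · simp only [mate, dif_neg hex] at hx
      exact (e' x).2.ne hx
  have hφ : ∀ u v : ℕ, ∃ φ : Fin m ↪o Fin (m * (n + 2)), u < v → v ≤ n →
      (φ h).1 = m * (u + 1) ∧ (φ h').1 = m * (v + 1) := by
    intro u v
    by_cases huv : u < v ∧ v ≤ n
    · obtain ⟨φ, hφ⟩ := exists_orderEmbedding_of_lt hh huv.1 huv.2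
      exact ⟨φ, fun _ _ ↦ hφ⟩
    · exact ⟨Fin.castLEOrderEmb (Nat.le_mul_of_pos_right m (by omega)),
        fun h1 h2 ↦ absurd ⟨h1, h2⟩ huv⟩
  choose φ hφ using hφ
  let f : H'.V → (Fin m ↪o Fin N) × Fin m := fun x ↦
    if (e' x).1 < mate x then ((φ (e' x) (mate x)).trans t, h)
    else ((φ (mate x) (e' x)).trans t, h')
  -- Every vertex `x` is placed at the same position, whichever copy of `H` it belongs to.
  have hf : ∀ x, ∃ i : Fin (m * (n + 2)), i.1 = m * ((e' x).1 + 1) ∧ (f x).1 (f x).2 = t i := by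
    intro x
    by_cases hx : (e' x).1 < mate x
    · simp only [f, if_pos hx]
      exact ⟨_, (hφ _ _ hx (hmate_le x)).1, rfl⟩
    · simp only [f, if_neg hx]
      have := hmate_ne x
      exact ⟨_, (hφ _ _ (by omega) (e' x).2.le).2, rfl⟩
  refine hB ⟨f, fun x y hxy ↦ ofPos_lt _ _ ?_, fun x y hxy ↦ ?_⟩
  · obtain ⟨i, hi, hi'⟩ := hf x
    obtain ⟨j, hj, hj'⟩ := hf y
    rw [hi', hj', t.lt_iff_lt, Fin.lt_def, hi, hj]
    have : (e' x).1 < (e' y).1 := e'.lt_iff_lt.2 hxy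
    exact Nat.mul_lt_mul_of_pos_left (by omega) hm
  · have key : ∀ {x y}, H'.graph.Adj x y → x < y → B.Adj (f x) (f y) := by
      intro x y hxy hlt'
      have h1 : (e' x).1 < (e' y).1 := e'.lt_iff_lt.2 hlt'
      simp only [f, hmate hxy, hmate hxy.symm, if_pos h1, if_neg h1.asymm]
      exact (hlt _).2
    rcases lt_or_gt_of_ne hxy.ne with hlt' | hlt'
    · exact key hxy hlt'
    · exact (key hxy.symm hlt').symm

theorem exists_isForest_isRamsey_of_isPartialMatching {H : OrderedGraph.{v}} {H' : OrderedGraph.{w}}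
    (hH : H.graph.edgeSet.Nonempty) (hF : H.IsForest) (hH' : H'.IsPartialMatching) :
    ∃ F : OrderedGraph.{0}, F.IsRamsey H H' ∧ F.IsForest := by
  let : Fintype H.V := Fintype.ofFinite _
  let e := Fintype.orderIsoFinOfCardEq H.V rfl
  obtain ⟨N, hN⟩ := exists_isRamsey_copies hH hH' e
  exact ⟨_, hN, isForest_copies (hF.of_comap e.toEquiv.toEmbedding) N⟩

theorem exists_isPartialMatching_isRamsey {H : OrderedGraph.{v}} {H' : OrderedGraph.{w}}
    (hH : H.graph.edgeSet.Nonempty) (hF : H.IsPartialMatching) (hH' : H'.IsPartialMatching) :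
    ∃ F : OrderedGraph.{0}, F.IsRamsey H H' ∧ F.IsPartialMatching := by
  let : Fintype H.V := Fintype.ofFinite _
  let e := Fintype.orderIsoFinOfCardEq H.V rfl
  obtain ⟨N, hN⟩ := exists_isRamsey_copies hH hH' e
  exact ⟨_, hN, isPartialMatching_copies (fun x y z hxy hxz ↦
    e.injective (isPartialMatching_iff.1 hF _ _ _ hxy hxz)) N⟩

end OrderedGraph

/-! ### Ramsey graphs for forests of stars -/

namespace OrderedGraph

/-- `y` lies to the right of `x` if `s` is true, and to the left of `x` if `s` is false. -/
def OnSide {α : Type*} [LT α] (s : Bool) (x y : α) : Prop := if s then x < y else y < x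

/-- The components of `H` are stars, `κ` maps each vertex to the center of its component, and `σ`
tells for each vertex whether the leaves of its component lie to the right or to the left of the
center. -/
def IsStarCentering (H : OrderedGraph.{u}) (κ : H.V → H.V) (σ : H.V → Bool) : Prop :=
  ∀ ⦃a b⦄, H.graph.Adj a b →
    (κ a = b ∧ κ b = b ∧ OnSide (σ b) b a) ∨ (κ b = a ∧ κ a = a ∧ OnSide (σ a) a b)

theorem exists_isStarCentering {H : OrderedGraph.{u}} (τ : H.graph.ConnectedComponent → Bool)
    (hr : ∀ C, τ C = true → (H.component C).IsRightStar)
    (hl : ∀ C, τ C = false → (H.component C).IsLeftStar) :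
    ∃ κ, H.IsStarCentering κ fun x ↦ τ (H.graph.connectedComponentMk x) := by
  have hz : ∀ C, ∃ z : C.supp, (H.component C).graph = SimpleGraph.starGraph z ∧
      ∀ x : C.supp, x ≠ z → OnSide (τ C) z.1 x.1 := by
    intro C
    cases h : τ C with
    | true =>
      obtain ⟨z, h1, h2⟩ := hr C h
      exact ⟨z, h2, h1⟩
    | false =>
      obtain ⟨z, h1, h2⟩ := hl C h
      exact ⟨z, h2, h1⟩
  choose z hz hside using hz
  have hcomp : ∀ {a b}, H.graph.Adj a b →
      H.graph.connectedComponentMk a = H.graph.connectedComponentMk b :=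
    SimpleGraph.ConnectedComponent.connectedComponentMk_eq_of_adj
  -- By symmetry it is enough to treat the case that the second endpoint is the center.
  have key : ∀ {a b}, H.graph.Adj a b → (z (H.graph.connectedComponentMk b)).1 = b →
      (z (H.graph.connectedComponentMk a)).1 = b ∧
        OnSide (τ (H.graph.connectedComponentMk b)) b a := by
    intro a b hab hb
    refine ⟨by rw [hcomp hab, hb], ?_⟩
    have := hside (H.graph.connectedComponentMk b) ⟨a, hcomp hab⟩ fun h ↦
      hab.ne ((congrArg Subtype.val h).trans hb)
    rwa [hb] at this
  refine ⟨fun x ↦ (z (H.graph.connectedComponentMk x)).1, fun a b hab ↦ ?_⟩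
  have hstar : (H.component (H.graph.connectedComponentMk b)).graph.Adj ⟨a, hcomp hab⟩ ⟨b, rfl⟩ :=
    hab
  rw [hz, SimpleGraph.starGraph_adj] at hstar
  rcases hstar.2 with h | h
  · have ha : (z (H.graph.connectedComponentMk a)).1 = a := by
      rw [hcomp hab, ← h]
    exact Or.inr ⟨(key hab.symm ha).1, ha, (key hab.symm ha).2⟩
  · have hb : (z (H.graph.connectedComponentMk b)).1 = b := by
      rw [← h]
    exact Or.inl ⟨(key hab hb).1, hb, (key hab hb).2⟩

/-- The vertices of `leafBlocks`: those of the given graphs, and a leaf in each block for each of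
them. -/
abbrev LeafBlocksVert {m : ℕ} (D : Fin m → OrderedGraph.{0}) : Type :=
  (Σ j, (D j).V) ⊕ (Fin m × Σ j, (D j).V)

/-- The adjacency of `leafBlocks`. -/
inductive LeafBlocksAdj {m : ℕ} (D : Fin m → OrderedGraph.{0}) :
    LeafBlocksVert D → LeafBlocksVert D → Prop
  | core {j : Fin m} {x y : (D j).V} (h : (D j).graph.Adj x y) :
      LeafBlocksAdj D (.inl ⟨j, x⟩) (.inl ⟨j, y⟩)
  | toLeaf (i : Fin m) (x : Σ j, (D j).V) : LeafBlocksAdj D (.inl x) (.inr (i, x))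
  | ofLeaf (i : Fin m) (x : Σ j, (D j).V) : LeafBlocksAdj D (.inr (i, x)) (.inl x)

/-- The index of a vertex of a finite linear order. -/
noncomputable def index (G : OrderedGraph.{u}) : G.V → ℕ :=
  fun x ↦ ((@Fintype.orderIsoFinOfCardEq G.V _ (Fintype.ofFinite _) _ rfl).symm x).1

theorem index_strictMono (G : OrderedGraph.{u}) : StrictMono G.index := fun _ _ h ↦
  (OrderIso.lt_iff_lt (@Fintype.orderIsoFinOfCardEq G.V _ (Fintype.ofFinite _) _ rfl).symm).2 h

/-- The block that contains a vertex of `leafBlocks`. -/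
def leafBlock {m : ℕ} {D : Fin m → OrderedGraph.{0}} : LeafBlocksVert D → Fin m
  | .inl x => x.1
  | .inr y => y.1

/-- The disjoint union of the graphs `D j`, with pendant leaves: each vertex is joined to one leaf
in each block. The `j`th block consists of the vertices of `D j` and of leaves, and the blocks
follow each other from left to right. -/
noncomputable def leafBlocks {m : ℕ} (D : Fin m → OrderedGraph.{0}) : OrderedGraph.{0} :=
  ofPos (V := LeafBlocksVert D)
    { Adj := LeafBlocksAdj D
      symm := ⟨fun _ _ h ↦ by
        cases h with
        | core h => exact .core h.symm
        | toLeaf i x => exact .ofLeaf i x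
        | ofLeaf i x => exact .toLeaf i x⟩
      loopless := ⟨fun _ h ↦ by
        cases h with
        | core h => exact h.ne rfl⟩ }
    fun x ↦ toLex (leafBlock x, Sum.elim (fun y ↦ (D y.1).index y.2) (fun _ ↦ 0) x)

section leafBlocks

variable {m : ℕ} {D : Fin m → OrderedGraph.{0}}

theorem leafBlocks_lt {x y : LeafBlocksVert D} (h : leafBlock x < leafBlock y) :
    (leafBlocks D).order.lt x y :=
  ofPos_lt _ _ (Prod.Lex.toLex_lt_toLex.2 (Or.inl h))

theorem leafBlocks_inl_lt {j : Fin m} {x y : (D j).V} (h : x < y) :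
    (leafBlocks D).order.lt (.inl ⟨j, x⟩ : LeafBlocksVert D) (.inl ⟨j, y⟩ : LeafBlocksVert D) :=
  ofPos_lt _ _ (Prod.Lex.toLex_lt_toLex.2 (Or.inr ⟨rfl, (D j).index_strictMono h⟩))

theorem isForest_leafBlocks (hD : ∀ j, (D j).IsForest) : (leafBlocks D).IsForest := by
  choose r hr using fun j ↦ SimpleGraph.IsAcyclic.exists_isForestRank (hD j)
  -- Leaves get a higher rank than their neighbors.
  refine SimpleGraph.IsForestRank.isAcyclic (r := fun x : LeafBlocksVert D ↦
    Sum.elim (fun y ↦ r y.1 y.2) (fun y ↦ r y.2.1 y.2.2 + 1) x) ⟨?_, ?_⟩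
  · intro x y h
    cases h with
    | core h => exact (hr _).ne_of_adj h
    | toLeaf i x => simp
    | ofLeaf i x => simp
  · intro x y z h1 h2 h3 h4
    cases h1 with
    | core h1 =>
      cases h2 with
      | core h2 => rw [(hr _).eq_of_lt h1 h2 h3 h4]
      | toLeaf i x => simp at h4
    | toLeaf i x => simp at h3
    | ofLeaf i x =>
      cases h2
      rfl

end leafBlocks

/-- The ordered graph `G` without the vertex `w`. -/
abbrev deleteVert (G : OrderedGraph.{u}) (w : G.V) : OrderedGraph.{u} where
  V := ({w}ᶜ : Set G.V)
  graph := G.graph.induce {w}ᶜ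

/-- For each `j`, let `w j` be the last vertex of `H'` if the leaves of `j` are to lie on the right,
and the first one if they are to lie on the left. If the block of `j` holds a Ramsey graph of `H`
and `H'` without `w j`, then it has a red copy of `H`, or a blue copy of `H'` without `w j` which
becomes a blue copy of `H'` once a leaf, on the proper side, of the vertex `x j` in place of the
neighbor of `w j` is joined to it in blue. If all these leaves are joined to `x j` in red for all
`j`, then the vertices `x j` are the centers of red stars with leaves in all blocks on the proper
side, and these stars contain a copy of `H`. -/
theorem isRamsey_leafBlocks {H : OrderedGraph.{v}} {H' : OrderedGraph.{w}} {κ : H.V → H.V}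
    {σ : H.V → Bool} (hκ : H.IsStarCentering κ σ) {m : ℕ} (e : H.V ≃o Fin m)
    {D : Fin m → OrderedGraph.{0}} {w : Fin m → H'.V}
    (hw : ∀ j x, x ≠ w j → OnSide (σ (e.symm j)) x (w j))
    (hw' : ∀ j, {x | H'.graph.Adj (w j) x}.Subsingleton)
    (hne : ∀ j, Nonempty (D j).V) (hD : ∀ j, (D j).IsRamsey H (H'.deleteVert (w j))) :
    (leafBlocks D).IsRamsey H H' := by
  classical
  refine isRamsey_iff.2 fun A B hAB ↦ ?_
  by_contra hcon
  rw [not_or] at hcon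
  obtain ⟨hA, hB⟩ := hcon
  let core : ∀ j, (D j).V → (leafBlocks D).V := fun j x ↦ (.inl ⟨j, x⟩ : LeafBlocksVert D)
  let leaf : Fin m → ∀ j, (D j).V → (leafBlocks D).V :=
    fun i j x ↦ (.inr (i, ⟨j, x⟩) : LeafBlocksVert D)
  have hred : ∀ j, ∃ x : (D j).V, ∀ i, OnSide (σ (e.symm j)) j i →
      A.Adj (leaf i j x) (core j x) := by
    intro j
    have hcopy := (isRamsey_iff.1 (hD j) (A.comap (core j)) (B.comap (core j)) fun x y hxy ↦
      hAB (LeafBlocksAdj.core hxy)).resolve_left ?_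
    · obtain ⟨f, hf, hadj⟩ := hcopy
      obtain ⟨x, hx⟩ : ∃ x : (D j).V, ∀ y : ({w j}ᶜ : Set H'.V), H'.graph.Adj (w j) y → f y = x := by
        by_cases hex : ∃ y : ({w j}ᶜ : Set H'.V), H'.graph.Adj (w j) y
        · obtain ⟨y, hy⟩ := hex
          exact ⟨f y, fun z hz ↦ congrArg f (Subtype.ext (hw' j hz hy))⟩
        · exact ⟨Classical.arbitrary _, fun y hy ↦ absurd ⟨y, hy⟩ hex⟩
      refine ⟨x, fun i hi ↦ ?_⟩
      refine (hAB (LeafBlocksAdj.ofLeaf i ⟨j, x⟩)).resolve_right fun hblue ↦ hB ?_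
      let g : H'.V → (leafBlocks D).V :=
        fun y ↦ if hy : y = w j then leaf i j x else core j (f ⟨y, hy⟩)
      have hgw : g (w j) = leaf i j x := dif_pos rfl
      have hg : ∀ {y} (hy : y ≠ w j), g y = core j (f ⟨y, hy⟩) := fun hy ↦ dif_neg hy
      have hgadj : ∀ {y}, H'.graph.Adj (w j) y → B.Adj (g (w j)) (g y) := by
        intro y hy
        rw [hgw, hg hy.ne.symm, hx ⟨y, hy.ne.symm⟩ hy]
        exact hblue
      refine ⟨g, fun y z hyz ↦ ?_, fun y z hyz ↦ ?_⟩
      · by_cases hy : y = w j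
        · have hz : z ≠ w j := fun hz ↦ hyz.ne (hy.trans hz.symm)
          have hside := hw j z hz
          rw [hy, hgw, hg hz]
          rw [← hy] at hside
          cases hs : σ (e.symm j) with
          | true => simp [OnSide, hs, hyz.asymm] at hside
          | false => exact leafBlocks_lt (show i < j by simpa [OnSide, hs] using hi)
        · by_cases hz : z = w j
          · have hside := hw j y hy
            rw [hz, hgw, hg hy]
            rw [← hz] at hside
            cases hs : σ (e.symm j) with
            | true => exact leafBlocks_lt (show j < i by simpa [OnSide, hs] using hi)
            | false => simp [OnSide, hs, hyz.asymm] at hside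
          · rw [hg hy, hg hz]
            exact leafBlocks_inl_lt (hf hyz)
      · by_cases hy : y = w j
        · subst hy
          exact hgadj hyz
        · by_cases hz : z = w j
          · subst hz
            exact (hgadj hyz.symm).symm
          · change B.Adj (g y) (g z)
            rw [hg hy, hg hz]
            exact hadj ⟨y, hy⟩ ⟨z, hz⟩ hyz
    · rintro ⟨f, hf, hadj⟩
      exact hA ⟨fun y ↦ core j (f y), fun y z hyz ↦ leafBlocks_inl_lt (hf hyz), hadj⟩
  choose x hx using hred
  let g : H.V → (leafBlocks D).V := fun a ↦
    if κ a = a then core (e a) (x (e a)) else leaf (e a) (e (κ a)) (x (e (κ a)))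
  have hblock : ∀ a, leafBlock (D := D) (g a) = e a := by
    intro a
    by_cases ha : κ a = a
    · simp only [g, if_pos ha]
      rfl
    · simp only [g, if_neg ha]
      rfl
  have key : ∀ {a b}, H.graph.Adj a b → κ a = b → κ b = b → OnSide (σ b) b a →
      A.Adj (g a) (g b) := by
    intro a b hab ha hb hside
    have ha' : κ a ≠ a := fun h ↦ hab.ne (h.symm.trans ha)
    subst ha
    simp only [g, if_neg ha', if_pos hb]
    refine hx (e (κ a)) (e a) ?_
    rw [e.symm_apply_apply]
    simpa [OnSide] using hside
  refine hA ⟨g, fun a b hab ↦ leafBlocks_lt ?_, fun a b hab ↦ ?_⟩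
  · rw [hblock, hblock]
    exact e.lt_iff_lt.2 hab
  · rcases hκ hab with ⟨h1, h2, h3⟩ | ⟨h1, h2, h3⟩
    · exact key hab h1 h2 h3
    · exact (key hab.symm h1 h2 h3).symm

theorem AtMostOneLeftNeighbor.deleteVert {G : OrderedGraph.{u}} (h : G.AtMostOneLeftNeighbor)
    (w : G.V) : (G.deleteVert w).AtMostOneLeftNeighbor :=
  ContainsCopy.atMostOneLeftNeighbor ⟨Subtype.val, fun _ _ h ↦ h, fun _ _ h ↦ h⟩ h

theorem AtMostOneRightNeighbor.deleteVert {G : OrderedGraph.{u}} (h : G.AtMostOneRightNeighbor)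
    (w : G.V) : (G.deleteVert w).AtMostOneRightNeighbor :=
  ContainsCopy.atMostOneRightNeighbor ⟨Subtype.val, fun _ _ h ↦ h, fun _ _ h ↦ h⟩ h

/-- Induction on the number of vertices of `H'`. The Ramsey graphs are kept nonempty, because a
block of `leafBlocks` must supply a star center even if no vertex of `H'` is left. -/
theorem exists_isForest_isRamsey_of_isStarCentering {H : OrderedGraph.{v}} {H' : OrderedGraph.{w}}
    (hH : H.graph.edgeSet.Nonempty) {κ : H.V → H.V} {σ : H.V → Bool}
    (hκ : H.IsStarCentering κ σ)
    (hr : ∀ j, σ j = true → H'.AtMostOneLeftNeighbor)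
    (hl : ∀ j, σ j = false → H'.AtMostOneRightNeighbor) :
    ∃ F : OrderedGraph.{0}, F.IsRamsey H H' ∧ F.IsForest := by
  suffices h : ∀ n : ℕ, ∀ H' : OrderedGraph.{w}, Nat.card H'.V = n →
      (∀ j, σ j = true → H'.AtMostOneLeftNeighbor) →
      (∀ j, σ j = false → H'.AtMostOneRightNeighbor) →
      ∃ F : OrderedGraph.{0}, Nonempty F.V ∧ F.IsRamsey H H' ∧ F.IsForest by
    obtain ⟨F, -, hF⟩ := h _ H' rfl hr hl
    exact ⟨F, hF⟩
  intro n
  induction n with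
  | zero =>
    intro H' hcard _ _
    have : IsEmpty H'.V := (Nat.card_eq_zero.1 hcard).resolve_right (by simp [H'.finite])
    exact ⟨{ V := Unit, graph := ⊥ }, ⟨()⟩, isRamsey_iff.2 fun A B _ ↦
      Or.inr ⟨isEmptyElim, fun x ↦ isEmptyElim x, fun x ↦ isEmptyElim x⟩,
      SimpleGraph.isAcyclic_bot⟩
  | succ n ih =>
    intro H' hcard hr hl
    have : Nonempty H'.V := (Nat.card_pos_iff.1 (by omega)).1
    have hwD : ∀ j, ∃ w : H'.V, (∀ x, x ≠ w → OnSide (σ j) x w) ∧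
        {x | H'.graph.Adj w x}.Subsingleton := by
      intro j
      cases hs : σ j with
      | true =>
        obtain ⟨w, hw⟩ := Finite.exists_max (id : H'.V → H'.V)
        exact ⟨w, fun x hx ↦ lt_of_le_of_ne (hw x) hx, fun x hx y hy ↦
          hr j hs w ⟨lt_of_le_of_ne (hw x) hx.ne.symm, hx⟩ ⟨lt_of_le_of_ne (hw y) hy.ne.symm, hy⟩⟩
      | false =>
        obtain ⟨w, hw⟩ := Finite.exists_min (id : H'.V → H'.V)
        exact ⟨w, fun x hx ↦ lt_of_le_of_ne (hw x) hx.symm, fun x hx y hy ↦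
          hl j hs w ⟨lt_of_le_of_ne (hw x) hx.ne, hx⟩ ⟨lt_of_le_of_ne (hw y) hy.ne, hy⟩⟩
    choose w hw hw' using hwD
    have hF : ∀ j, ∃ F : OrderedGraph.{0}, Nonempty F.V ∧ F.IsRamsey H (H'.deleteVert (w j)) ∧
        F.IsForest := by
      intro j
      refine ih _ ?_ (fun i hi ↦ (hr i hi).deleteVert _) fun i hi ↦ (hl i hi).deleteVert _
      rw [Nat.card_coe_set_eq, Set.ncard_compl, Set.ncard_singleton, hcard]
      rfl
    choose D hne hD hforest using hF
    let : Fintype H.V := Fintype.ofFinite _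
    let e : H.V ≃o Fin (Fintype.card H.V) := (Fintype.orderIsoFinOfCardEq H.V rfl).symm
    refine ⟨leafBlocks fun j ↦ D (e.symm j), ?_, isRamsey_leafBlocks hκ e
      (fun j ↦ hw (e.symm j)) (fun j ↦ hw' _) (fun j ↦ hne _) fun j ↦ hD _,
      isForest_leafBlocks fun j ↦ hforest _⟩
    obtain ⟨x₀, hx₀⟩ := hH
    induction x₀ with
    | _ a b =>
      obtain ⟨x⟩ := hne (e.symm (e a))
      exact ⟨(.inl ⟨e a, x⟩ : LeafBlocksVert fun j ↦ D (e.symm j))⟩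

/-! ### Sufficiency of the conditions -/

theorem IsRightStarForest.exists_isForest_isRamsey {H : OrderedGraph.{v}} {H' : OrderedGraph.{w}}
    (h : H.IsRightStarForest) (hH : H.graph.edgeSet.Nonempty) (h' : H'.AtMostOneLeftNeighbor) :
    ∃ F : OrderedGraph.{0}, F.IsRamsey H H' ∧ F.IsForest := by
  obtain ⟨κ, hκ⟩ := exists_isStarCentering (fun _ ↦ true) (fun C _ ↦ h C) (by simp)
  exact exists_isForest_isRamsey_of_isStarCentering hH hκ (fun _ _ ↦ h') (by simp)

theorem IsLeftStarForest.exists_isForest_isRamsey {H : OrderedGraph.{v}} {H' : OrderedGraph.{w}}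
    (h : H.IsLeftStarForest) (hH : H.graph.edgeSet.Nonempty) (h' : H'.AtMostOneRightNeighbor) :
    ∃ F : OrderedGraph.{0}, F.IsRamsey H H' ∧ F.IsForest := by
  obtain ⟨κ, hκ⟩ := exists_isStarCentering (fun _ ↦ false) (by simp) (fun C _ ↦ h C)
  exact exists_isForest_isRamsey_of_isStarCentering hH hκ (by simp) (fun _ _ ↦ h')

theorem IsLeftRightStarForest.exists_isForest_isRamsey {H : OrderedGraph.{v}}
    {H' : OrderedGraph.{w}} (h : H.IsLeftRightStarForest) (hH : H.graph.edgeSet.Nonempty)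
    (h' : H'.IsMonotonePathForest) : ∃ F : OrderedGraph.{0}, F.IsRamsey H H' ∧ F.IsForest := by
  classical
  obtain ⟨κ, hκ⟩ := exists_isStarCentering (fun C ↦ decide (H.component C).IsRightStar)
    (fun C hC ↦ of_decide_eq_true hC) (fun C hC ↦ (h C).resolve_right (of_decide_eq_false hC))
  exact exists_isForest_isRamsey_of_isStarCentering hH hκ (fun _ _ ↦ h'.atMostOneLeftNeighbor)
    (fun _ _ ↦ h'.atMostOneRightNeighbor)

theorem ForestCondition.exists_isForest_isRamsey {H : OrderedGraph.{v}} {H' : OrderedGraph.{w}}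
    (h : ForestCondition H H') (hH : H.graph.edgeSet.Nonempty) (hH' : H'.graph.edgeSet.Nonempty) :
    ∃ F : OrderedGraph.{0}, F.IsRamsey H H' ∧ F.IsForest := by
  have swap : (∃ F : OrderedGraph.{0}, F.IsRamsey H' H ∧ F.IsForest) →
      ∃ F : OrderedGraph.{0}, F.IsRamsey H H' ∧ F.IsForest :=
    fun ⟨F, hF, hF'⟩ ↦ ⟨F, hF.symm, hF'⟩
  obtain ⟨⟨hF, hF'⟩, (h | h) | (⟨h, h'⟩ | ⟨h, h'⟩) | (⟨h, h'⟩ | ⟨h, h'⟩) | (⟨h, h'⟩ | ⟨h, h'⟩)⟩ := h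
  · exact swap (exists_isForest_isRamsey_of_isPartialMatching hH' hF' h)
  · exact exists_isForest_isRamsey_of_isPartialMatching hH hF h
  · exact h.exists_isForest_isRamsey hH h'
  · exact swap (h.exists_isForest_isRamsey hH' h')
  · exact h.exists_isForest_isRamsey hH h'
  · exact swap (h.exists_isForest_isRamsey hH' h')
  · exact h.exists_isForest_isRamsey hH h'
  · exact swap (h.exists_isForest_isRamsey hH' h')

end OrderedGraph

theorem mainTheorem8 (H : OrderedGraph.{u}) (H' : OrderedGraph.{v})
    (hH : H.graph.edgeSet.Nonempty) (hH' : H'.graph.edgeSet.Nonempty) :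
    (OrderedGraph.ramseyDensity H H' < 1 ↔ OrderedGraph.ForestCondition H H') ∧
    ((∃ F ∈ OrderedGraph.ramseyGraphs H H', F.IsForest) ↔ OrderedGraph.ForestCondition H H') ∧
    ((∃ F ∈ OrderedGraph.ramseyGraphs H H', F.IsPartialMatching) ↔
      H.IsPartialMatching ∧ H'.IsPartialMatching) := by
  have hforest : (∃ F ∈ OrderedGraph.ramseyGraphs H H', F.IsForest) ↔
      OrderedGraph.ForestCondition H H' :=
    ⟨fun ⟨_, hR, hF⟩ ↦ OrderedGraph.IsRamsey.forestCondition hR hF hH hH',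
      fun h ↦ h.exists_isForest_isRamsey hH hH'⟩
  refine ⟨OrderedGraph.ramseyDensity_lt_one_iff.trans hforest, hforest, ?_, ?_⟩
  · rintro ⟨F, hR, hF⟩
    have hR : F.IsRamsey H H' := hR
    exact ⟨(hR.containsCopy_left hH').isPartialMatching hF,
      (hR.symm.containsCopy_left hH).isPartialMatching hF⟩
  · rintro ⟨h, h'⟩
    exact OrderedGraph.exists_isPartialMatching_isRamsey hH h h'
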